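/- Let $(\mathcal J,\circ)$ be a nonzero Euclidean Jordan algebra, i.e. a nonzero finite-dimensional real vector space with a bilinear product $\circ$ satisfying $x\circ y=y\circ x$ and $x^2\circ(x\circ y)=x\circ(x^2\circ y)$ (where $x^2=x\circ x$), with an identity element $e$, that admits an inner product $(\cdot\mid\cdot)$ with $(x\circ y\mid z)=(y\mid x\circ z)$ for all $x,y,z$. A primitive idempotent is a nonzero $q$ with $q^2=q$ that is not the sum of two nonzero idempotents; a Jordan frame is a family $q_1,\dots,q_r$ of primitive idempotents with $q_i\circ q_j=0$ for $i\ne j$ and $\sum_i q_i=e$. Every $x\in\mathcal J$ has a spectral decomposition $x=\sum_i\lambda_iq_i$ over some Jordan frame, and $\mathrm{tr}(x):=\sum_i\lambda_i$, $\mathbf{exp}(x):=\sum_i e^{\lambda_i}q_i$ and, if all $\lambda_i>0$, $\mathbf{ln}\,x:=\sum_i\ln(\lambda_i)q_i$ do not depend on the decomposition. Put $\langle x,y\rangle=\mathrm{tr}(x\circ y)$, let $\mathcal K=\{x^2:x\in\mathcal J\}$ be the cone of squares (the symmetric cone of $\mathcal J$), $\Delta=\{x\in\mathcal K:\mathrm{tr}(x)=1\}$,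 and let $$\Phi(x)=\mathrm{tr}(x\circ\mathbf{ln}\,x)=\sum_i\lambda_i\ln\lambda_i\quad(x\in\mathcal K,\ 0\ln 0=0),\qquad \mathcal H_\Phi(x,y)=\Phi(x)-\Phi(y)-\langle\nabla\Phi(y),x-y\rangle\quad(x\in\mathcal K,\ y\in\mathrm{int}(\mathcal K))$$ be the symmetric-cone negative entropy and its Bregman divergence. Let $\eta\in\mathbb R$ and let $m_1,m_2,\dots\in\mathcal J$ be arbitrary. Consider the following three schemes, where $p=\operatorname{argmin}$ means that $p$ is the unique minimizer. * SCMWU: $\displaystyle p_{t+1}=\frac{\mathbf{exp}\big(-\eta\sum_{i=1}^t m_i\big)}{\mathrm{tr}\big(\mathbf{exp}(-\eta\sum_{i=1}^t m_i)\big)}$ for all $t\ge 0$. * FTRL: $\displaystyle p_{t+1}=\operatorname*{argmin}_{x\in\Delta}\Big\{\Phi(x)+\eta\sum_{i=1}^t\langle m_i,x\rangle\Big\}$ for all $t\ge 0$. * OMD: $\displaystyle p_1=\operatorname*{argmin}_{x\in\Delta}\Phi(x)$ and $\displaystyle p_{t+1}=\operatorname*{argmin}_{x\in\Delta}\big\{\eta\langle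 m_t,x\rangle+\mathcal H_\Phi(x,p_t)\big\}$ for all $t\ge 1$. Then the iterates of the three schemes coincide: a sequence $p_1,p_2,\dots$ in $\mathcal J$ satisfies SCMWU if and only if it satisfies FTRL, and if and only if it satisfies OMD. In particular all the minimizers above exist and are unique. Moreover every iterate $p_t$ lies in $\mathrm{int}(\mathcal K)$, and $\Phi$ is differentiable there, so that $\mathcal H_\Phi(\cdot,p_t)$ is well defined. -/

import Mathlib

/-- A Euclidean Jordan algebra: a finite-dimensional real vector space with a bilinear commutative
product `*` satisfying the Jordan identity, with an identity element `1`, and with an inner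
product which is associative, `⟪x * y, z⟫ = ⟪y, x * z⟫`.  The product is not assumed to be
associative, and the norm is only the one induced by the inner product. -/
class EuclideanJordanAlgebra (J : Type*) extends NormedAddCommGroup J, InnerProductSpace ℝ J,
    NonAssocCommRing J, IsScalarTower ℝ J J, SMulCommClass ℝ J J, IsCommJordan J,
    FiniteDimensional ℝ J where
  inner_mul_assoc : ∀ x y z : J, Inner.inner ℝ (x * y) z = Inner.inner ℝ y (x * z)

namespace SymmetricCone

/-- A primitive idempotent: a nonzero idempotent that is not the sum of two nonzero idempotents. -/
structure IsPrimitiveIdempotent {J : Type*} [EuclideanJordanAlgebra J] (q : J) : Prop where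
  idem : q * q = q
  ne_zero : q ≠ 0
  primitive : ∀ a b : J, a * a = a → b * b = b → a + b = q → a = 0 ∨ b = 0

/-- A Jordan frame: pairwise orthogonal primitive idempotents that sum up to the identity. -/
structure IsJordanFrame {J : Type*} [EuclideanJordanAlgebra J] {n : ℕ} (q : Fin n → J) :
    Prop where
  primitive : ∀ i, IsPrimitiveIdempotent (q i)
  orthogonal : ∀ i j, i ≠ j → q i * q j = 0
  sum_eq_one : ∑ i, q i = 1

/-- A (type-II) spectral decomposition `x = ∑ i, λ i • q i` of `x` over a Jordan frame `q`. -/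
structure SpectralDecomposition {J : Type*} [EuclideanJordanAlgebra J] (x : J) where
  card : ℕ
  eigenvalue : Fin card → ℝ
  frame : Fin card → J
  isJordanFrame : IsJordanFrame frame
  eq_sum : x = ∑ i, eigenvalue i • frame i

open Classical in
/-- The trace `tr x = ∑ i, λ i`, the sum of the eigenvalues of `x` in a spectral decomposition.
Every element has a spectral decomposition, and the sum does not depend on the chosen one. -/
noncomputable def tr {J : Type*} [EuclideanJordanAlgebra J] (x : J) : ℝ :=
  if h : Nonempty (SpectralDecomposition x) then ∑ i, h.some.eigenvalue i else 0

open Classical in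
/-- The Löwner extension of `f : ℝ → ℝ`: it maps `x = ∑ i, λ i • q i` to `∑ i, f (λ i) • q i`.
Every element has a spectral decomposition, and the value does not depend on the chosen one. -/
noncomputable def lowner {J : Type*} [EuclideanJordanAlgebra J] (f : ℝ → ℝ) (x : J) : J :=
  if h : Nonempty (SpectralDecomposition x) then
    ∑ i, f (h.some.eigenvalue i) • h.some.frame i
  else 0

/-- The Jordan-algebra exponential. -/
noncomputable def jexp {J : Type*} [EuclideanJordanAlgebra J] (x : J) : J :=
  lowner Real.exp x

/-- The Jordan-algebra logarithm (meaningful on the interior of the cone of squares; as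
`Real.log 0 = 0`, zero eigenvalues are mapped to zero). -/
noncomputable def jlog {J : Type*} [EuclideanJordanAlgebra J] (x : J) : J :=
  lowner Real.log x

/-- The inner product `⟨x, y⟩ = tr (x ∘ y)`. -/
noncomputable def trInner {J : Type*} [EuclideanJordanAlgebra J] (x y : J) : ℝ :=
  tr (x * y)

/-- The cone of squares of `J`. -/
def cone (J : Type*) [EuclideanJordanAlgebra J] : Set J :=
  {x : J | ∃ y : J, y * y = x}

/-- The trace-one slice of the cone of squares. -/
def slice (J : Type*) [EuclideanJordanAlgebra J] : Set J :=
  {x : J | x ∈ cone J ∧ tr x = 1}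

/-- The symmetric-cone negative entropy `Φ x = tr (x ∘ ln x) = ∑ i, λ i * ln (λ i)`, on the whole
cone with the usual convention `0 ln 0 = 0`. -/
noncomputable def entropy {J : Type*} [EuclideanJordanAlgebra J] (x : J) : ℝ :=
  tr (x * jlog x)

/-- The Bregman divergence `Φ x - Φ y - ⟨∇Φ y, x - y⟩` of the entropy, where
`⟨∇Φ y, x - y⟩` is the derivative of `Φ` at `y` applied to `x - y`. -/
noncomputable def bregman {J : Type*} [EuclideanJordanAlgebra J] (x y : J) : ℝ :=
  entropy x - entropy y - fderiv ℝ (entropy : J → ℝ) y (x - y)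

/-- `p = argmin_{x ∈ S} f x`: `p` is the unique minimizer of `f` over `S`. -/
def IsArgmin {J : Type*} (S : Set J) (f : J → ℝ) (p : J) : Prop :=
  p ∈ S ∧ ∀ x ∈ S, x ≠ p → f p < f x

/-- `p 1, p 2, …` are the iterates of the Symmetric-Cone Multiplicative Weights Update with step
size `η` and loss vectors `m 1, m 2, …` (the values `p 0` and `m 0` play no role). -/
def IsSCMWU {J : Type*} [EuclideanJordanAlgebra J] (η : ℝ) (m p : ℕ → J) : Prop :=
  ∀ t : ℕ, p (t + 1) =
    (tr (jexp (-η • ∑ i ∈ Finset.Icc 1 t, m i)))⁻¹ • jexp (-η • ∑ i ∈ Finset.Icc 1 t, m i)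

/-- `p 1, p 2, …` are the iterates of Follow-the-Regularized-Leader. -/
def IsFTRL {J : Type*} [EuclideanJordanAlgebra J] (η : ℝ) (m p : ℕ → J) : Prop :=
  ∀ t : ℕ, IsArgmin (slice J)
    (fun x => entropy x + η * ∑ i ∈ Finset.Icc 1 t, trInner (m i) x) (p (t + 1))

/-- `p 1, p 2, …` are the iterates of Online Mirror Descent. -/
def IsOMD {J : Type*} [EuclideanJordanAlgebra J] (η : ℝ) (m p : ℕ → J) : Prop :=
  IsArgmin (slice J) (fun x => entropy x) (p 1) ∧
  ∀ t : ℕ, 1 ≤ t → IsArgmin (slice J)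
    (fun x => η * trInner (m t) x + bregman x (p t)) (p (t + 1))

end SymmetricCone

/-!
The heart of the matter is the Gibbs variational principle: on the slice `Δ`, a function
`x ↦ Φ x - ⟨a, x⟩` is up to a constant the relative entropy of `x` with respect to
`gibbs a = exp a / tr (exp a)`, because `ln (gibbs a) = a - ln (tr (exp a)) • 1`.  Klein's
inequality says that the relative entropy is nonnegative and vanishes only on the diagonal, so
`gibbs a` is the unique minimizer (`isArgmin_gibbs`).  The FTRL objective has this form with
`a = -η ∑ m i`.  The Bregman divergence of `Φ` is the relative entropy, hence the OMD objective at
`p t = gibbs a` has this form with `a - η m t` in place of `a`.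

For Klein's inequality, let `x = ∑ λ i • q i` and `y = ∑ μ j • s j` over Jordan frames.  The
relative entropy is `∑ i j, k (λ i) (μ j) * tr (q i * s j)`, where the overlaps `tr (q i * s j)` are
nonnegative and sum up to `1` along each row and column, and
`0 ≤ k (λ, μ) = λ ln λ - λ ln μ - λ + μ ≤ (λ - μ)² / μ`.  The lower bound gives positivity
(`relEntropy_pos`); the upper bound makes the relative entropy `O(tr ((x - y)²))`, which is
differentiability of `Φ` with gradient `ln y + 1` at points with positive eigenvalues
(`hasFDerivAt_entropy`).

The structure theory behind this is the spectral theorem (`nonempty_spectralDecomposition`) and the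
linearity of the trace (`tr_eq_inner`).

* Multiplication by `x` is self-adjoint, and diagonalizing it on a space of elements that
  operator-commute with `x` splits `1` into eigenvectors, which turn out to be orthogonal
  idempotents.  Multiplication by an idempotent `c` satisfies `2 L³ - 3 L² + L = 0`, so it is
  positive semidefinite, and idempotents have nonnegative inner products, which vanish exactly when
  the idempotents are orthogonal for the product.
* For a primitive idempotent `q` the Peirce `1`-space is the line through `q`.  Hence
  `‖q * s‖² = (1 + ⟪q, s⟫ / ‖q‖²) * ⟪q, s⟫ / 2` for an idempotent `s`, and exchanging the roles of
  two primitive idempotents shows that they have the same norm unless they are orthogonal.  So for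
  a fixed Jordan frame the element `w = ∑ q i / ‖q i‖²` acts on every primitive idempotent `s` as
  the scalar `1 / ‖s‖²`, which gives `⟪w, s⟫ = 1` and `tr x = ⟪w, x⟫`.
-/

namespace SymmetricCone

open scoped InnerProductSpace
open Finset

variable {J : Type*} [EuclideanJordanAlgebra J]

/-! ### Linearized Jordan identity and idempotents -/

lemma inner_mul_assoc (x y z : J) : ⟪x * y, z⟫_ℝ = ⟪y, x * z⟫_ℝ :=
  EuclideanJordanAlgebra.inner_mul_assoc x y z

/-- The polarized Jordan identity with one repeated variable, solved for the product by
`x * (x * y)`. -/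
lemma mul_mul_mul_eq (x y z : J) :
    (x * (x * y)) * z = (2 : ℝ) • ((x * y) * (x * z)) + (x * x) * (y * z) - x * (x * (y * z))
      - y * (x * (x * z)) := by
  have h := congrArg (fun f : AddMonoid.End J => f x)
    (two_nsmul_lie_lmul_lmul_add_add_eq_zero (A := J) x y z)
  simp only [Ring.lie_def, AddMonoid.End.mulLeft] at h
  have h2 : (2 : ℕ) • (x * ((y * z) * x) - (y * z) * (x * x) + (y * ((z * x) * x) -
      (z * x) * (y * x)) + (z * ((x * y) * x) - (x * y) * (z * x))) = 0 := h
  rw [← Nat.cast_smul_eq_nsmul ℝ, smul_eq_zero] at h2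
  have h3 := h2.resolve_left (by norm_num)
  rw [mul_comm z (x * y * x), mul_comm (x * y) x, mul_comm (y * z) x, mul_comm (y * z) (x * x),
    mul_comm z x, mul_comm (x * z) x, mul_comm y x, mul_comm (x * z) (x * y)] at h3
  rw [two_smul, ← sub_eq_zero, ← h3]
  abel

/-- Multiplication by an idempotent satisfies `2 L³ - 3 L² + L = 0`. -/
lemma idempotent_cubic {c : J} (hc : c * c = c) (z : J) :
    c * z = (3 : ℝ) • (c * (c * z)) - (2 : ℝ) • (c * (c * (c * z))) := by
  have h := mul_mul_mul_eq c c z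
  simp only [hc] at h
  exact h.trans (by module)

/-- Multiplication by an idempotent is a sum of squares of self-adjoint operators. -/
lemma inner_idempotent_mul {c : J} (hc : c * c = c) (z : J) :
    ⟪c * z, z⟫_ℝ = ‖c * z‖ ^ 2 + 4 * ‖c * z - c * (c * z)‖ ^ 2 := by
  have h1 := congrArg (fun u => ⟪u, z⟫_ℝ) (idempotent_cubic hc z)
  have h2 := congrArg (fun u => ⟪u, c * z⟫_ℝ) (idempotent_cubic hc z)
  simp only [inner_sub_left, inner_smul_left, RCLike.conj_to_real] at h1 h2
  rw [← real_inner_self_eq_norm_sq, ← real_inner_self_eq_norm_sq]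
  simp only [inner_sub_left, inner_sub_right]
  rw [inner_mul_assoc c (c * z) z, inner_mul_assoc c (c * (c * z)) z] at h1
  rw [inner_mul_assoc c (c * (c * z)) (c * z)] at h2
  rw [inner_mul_assoc c (c * z) (c * z)] at h2 ⊢
  have e : ⟪c * z, c * (c * z)⟫_ℝ = ⟪c * (c * z), c * z⟫_ℝ := real_inner_comm _ _
  linarith

lemma inner_idempotent_mul_nonneg {c : J} (hc : c * c = c) (z : J) : 0 ≤ ⟪c * z, z⟫_ℝ := by
  rw [inner_idempotent_mul hc]; positivity

lemma inner_idempotent_eq {c d : J} (hd : d * d = d) : ⟪c, d⟫_ℝ = ⟪c * d, d⟫_ℝ := by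
  rw [mul_comm, inner_mul_assoc, hd]

lemma inner_idempotent_nonneg {c d : J} (hc : c * c = c) (hd : d * d = d) : 0 ≤ ⟪c, d⟫_ℝ := by
  rw [inner_idempotent_eq hd]; exact inner_idempotent_mul_nonneg hc d

/-- Idempotents that are orthogonal for the inner product are orthogonal for the product. -/
lemma mul_eq_zero_of_inner_eq_zero {c d : J} (hc : c * c = c) (hd : d * d = d)
    (h : ⟪c, d⟫_ℝ = 0) : c * d = 0 := by
  rw [inner_idempotent_eq hd, inner_idempotent_mul hc] at h
  have : ‖c * d‖ ^ 2 = 0 := le_antisymm (by nlinarith [sq_nonneg ‖c * d - c * (c * d)‖])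
    (sq_nonneg _)
  simpa using this

lemma inner_one_idempotent {c : J} (hc : c * c = c) : ⟪(1 : J), c⟫_ℝ = ‖c‖ ^ 2 := by
  rw [inner_idempotent_eq hc, one_mul, real_inner_self_eq_norm_sq]

lemma one_sub_idem {c : J} (hc : c * c = c) : (1 - c) * (1 - c) = 1 - c := by
  simp [mul_sub, sub_mul, hc]

/-- Idempotents that sum up to the identity are automatically pairwise orthogonal. -/
lemma orthogonal_of_sum_eq_one {ι : Type*} [Fintype ι] {q : ι → J} (hq : ∀ i, q i * q i = q i)
    (h : ∑ i, q i = 1) {i j : ι} (hij : i ≠ j) : q i * q j = 0 := by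
  classical
  apply mul_eq_zero_of_inner_eq_zero (hq i) (hq j)
  have h1 : ∑ k, ⟪q k, q j⟫_ℝ = ‖q j‖ ^ 2 := by
    rw [← sum_inner, h, inner_one_idempotent (hq j)]
  rw [← Finset.add_sum_erase _ _ (mem_univ j), real_inner_self_eq_norm_sq, add_eq_left] at h1
  exact (Finset.sum_eq_zero_iff_of_nonneg
    fun k _ => inner_idempotent_nonneg (hq k) (hq j)).1 h1 i (by simp [hij])

/-! ### Spectral theorem -/

/-- The elements `y` such that both `y` and `x * y` operator-commute with `x`.  It is a space
containing `1` and stable under multiplication by `x`, hence it contains the powers of `x`. -/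
def powerCommutant (x : J) : Submodule ℝ J where
  carrier := {y | (∀ z, y * (x * z) = x * (y * z)) ∧ ∀ z, (x * y) * (x * z) = x * ((x * y) * z)}
  zero_mem' := by simp
  add_mem' := by
    rintro a b ⟨ha, ha'⟩ ⟨hb, hb'⟩
    constructor <;> intro z
    · rw [add_mul, ha, hb, add_mul, mul_add]
    · rw [mul_add, add_mul, ha', hb', add_mul, mul_add]
  smul_mem' := by
    rintro r a ⟨ha, ha'⟩
    constructor <;> intro z
    · rw [smul_mul_assoc, ha, smul_mul_assoc, mul_smul_comm]
    · rw [mul_smul_comm, smul_mul_assoc, ha', smul_mul_assoc, mul_smul_comm]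

lemma one_mem_powerCommutant (x : J) : (1 : J) ∈ powerCommutant x :=
  ⟨fun z => by simp, fun z => by simp⟩

lemma sq_mul_mul_comm (x z : J) : (x * x) * (x * z) = x * ((x * x) * z) := by
  rw [mul_comm (x * x) z, ← IsCommJordan.lmul_comm_rmul_rmul x z, mul_comm]

lemma mul_mem_powerCommutant (x : J) {y : J} (hy : y ∈ powerCommutant x) :
    x * y ∈ powerCommutant x := by
  obtain ⟨h1, h2⟩ := hy
  refine ⟨h2, fun z => ?_⟩
  rw [mul_mul_mul_eq x y (x * z), mul_mul_mul_eq x y z]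
  simp only [h1, h2, sq_mul_mul_comm, mul_add, mul_sub, mul_smul_comm]

/-- Spectral resolution: `1` splits into finitely many pairwise orthogonal idempotents indexed by
the eigenvalues of `x`. -/
lemma exists_spectral_resolution (x : J) : ∃ (s : Finset ℝ) (v : ℝ → J),
    (∀ r, v r * v r = v r) ∧ ∑ r ∈ s, v r = 1 ∧ ∑ r ∈ s, r • v r = x := by
  have hinv : ∀ y ∈ powerCommutant x, LinearMap.mulLeft ℝ x y ∈ powerCommutant x :=
    fun y hy => mul_mem_powerCommutant x hy
  -- the eigenvectors have to lie in `powerCommutant x` to multiply like commuting elements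
  have hsym : (LinearMap.mulLeft ℝ x).IsSymmetric := fun y z => by
    simpa using inner_mul_assoc x y z
  have hsym' := hsym.restrict_invariant hinv
  have htop : (⨆ r, Module.End.eigenspace ((LinearMap.mulLeft ℝ x).restrict hinv) r) = ⊤ := by
    rw [← Submodule.orthogonal_eq_bot_iff]
    exact hsym'.orthogonalComplement_iSup_eigenspaces_eq_bot
  obtain ⟨f, hf, hsum⟩ := (Submodule.mem_iSup_iff_exists_finsupp _ _).1
    (htop ▸ Submodule.mem_top : (⟨1, one_mem_powerCommutant x⟩ : powerCommutant x) ∈ _)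
  have hxf : ∀ r, x * (f r : J) = r • (f r : J) := fun r => by
    have := congrArg Subtype.val (Module.End.mem_eigenspace_iff.1 (hf r))
    simpa using this
  have hone : ∑ r ∈ f.support, (f r : J) = 1 := by
    have := congrArg Subtype.val hsum
    simpa [Finsupp.sum] using this
  have horth : ∀ r s, r ≠ s → (f r : J) * (f s : J) = 0 := fun r s hrs => by
    have h1 := (f r).2.1 (f s : J)
    have h2 := (f s).2.1 (f r : J)
    rw [hxf, mul_smul_comm] at h1 h2
    rw [mul_comm (f s : J), ← h1, ← sub_eq_zero, ← sub_smul, smul_eq_zero] at h2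
    exact h2.resolve_left (sub_ne_zero.2 hrs)
  refine ⟨f.support, fun r => f r, fun r => ?_, hone, ?_⟩
  · change (f r : J) * f r = f r
    by_cases hr : r ∈ f.support
    · conv_rhs => rw [← mul_one (f r : J), ← hone, mul_sum]
      rw [Finset.sum_eq_single r (fun s _ hs => horth r s hs.symm) (fun h => absurd hr h)]
    · simp [Finsupp.notMem_support_iff.1 hr]
  · conv_rhs => rw [← mul_one x, ← hone, mul_sum]
    exact Finset.sum_congr rfl fun r _ => (hxf r).symm

lemma exists_norm_mul_le (J : Type*) [EuclideanJordanAlgebra J] :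
    ∃ C : ℝ, 0 < C ∧ ∀ x y : J, ‖x * y‖ ≤ C * ‖x‖ * ‖y‖ := by
  let f : J →ₗ[ℝ] J →L[ℝ] J :=
    LinearMap.toContinuousLinearMap.toLinearMap ∘ₗ LinearMap.mul ℝ J
  refine ⟨‖LinearMap.toContinuousLinearMap f‖ + 1, by positivity, fun x y => ?_⟩
  have h1 := (LinearMap.toContinuousLinearMap f).le_opNorm x
  have h2 := ((LinearMap.toContinuousLinearMap f) x).le_opNorm y
  have h3 : (LinearMap.toContinuousLinearMap f) x y = x * y := rfl
  rw [h3] at h2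
  refine h2.trans (mul_le_mul_of_nonneg_right (h1.trans ?_) (norm_nonneg y))
  nlinarith [norm_nonneg x]

/-- The norms of nonzero idempotents are bounded below, so that splitting an idempotent into
smaller ones has to stop. -/
lemma exists_norm_idempotent_ge (J : Type*) [EuclideanJordanAlgebra J] :
    ∃ δ : ℝ, 0 < δ ∧ ∀ c : J, c * c = c → c ≠ 0 → δ ≤ ‖c‖ ^ 2 := by
  obtain ⟨C, hC, h⟩ := exists_norm_mul_le J
  refine ⟨(C⁻¹) ^ 2, by positivity, fun c hc h0 => ?_⟩
  have h1 := h c c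
  rw [hc] at h1
  have h2 : 0 < ‖c‖ := norm_pos_iff.2 h0
  refine pow_le_pow_left₀ (by positivity) ?_ 2
  rw [inv_le_iff_one_le_mul₀ hC]
  nlinarith

/-- Every idempotent is a sum of primitive ones, by repeated splitting. -/
lemma exists_primitive_list {c : J} (hc : c * c = c) :
    ∃ l : List J, (∀ q ∈ l, IsPrimitiveIdempotent q) ∧ l.sum = c := by
  obtain ⟨δ, hδ, hlow⟩ := exists_norm_idempotent_ge J
  -- splitting off a nonzero idempotent lowers `‖c‖²` by at least `δ`
  have key : ∀ n : ℕ, ∀ c : J, c * c = c → ‖c‖ ^ 2 ≤ n * δ →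
      ∃ l : List J, (∀ q ∈ l, IsPrimitiveIdempotent q) ∧ l.sum = c := by
    intro n
    induction n with
    | zero =>
      intro c hc hn
      by_cases h0 : c = 0
      · exact ⟨[], by simp, by simp [h0]⟩
      · have := hlow c hc h0
        simp only [Nat.cast_zero, zero_mul] at hn
        linarith
    | succ n ih =>
      intro c hc hn
      by_cases h0 : c = 0
      · exact ⟨[], by simp, by simp [h0]⟩
      by_cases hp : IsPrimitiveIdempotent c
      · exact ⟨[c], by simpa using hp, by simp⟩
      obtain ⟨a, b, ha, hb, hab, ha0, hb0⟩ : ∃ a b : J, a * a = a ∧ b * b = b ∧ a + b = c ∧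
          a ≠ 0 ∧ b ≠ 0 := by
        by_contra hcon
        refine hp ⟨hc, h0, fun a b ha hb hab => ?_⟩
        by_contra h
        rw [not_or] at h
        exact hcon ⟨a, b, ha, hb, hab, h.1, h.2⟩
      have hnorm : ‖c‖ ^ 2 = ‖a‖ ^ 2 + ‖b‖ ^ 2 := by
        rw [← inner_one_idempotent hc, ← hab, inner_add_right, inner_one_idempotent ha,
          inner_one_idempotent hb]
      push_cast at hn
      obtain ⟨l, hl, hls⟩ := ih a ha (by nlinarith [hlow b hb hb0])
      obtain ⟨k, hk, hks⟩ := ih b hb (by nlinarith [hlow a ha ha0])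
      refine ⟨l ++ k, fun q hq => ?_, by rw [List.sum_append, hls, hks, hab]⟩
      exact (List.mem_append.1 hq).elim (hl q) (hk q)
  obtain ⟨n, hn⟩ := exists_nat_ge (‖c‖ ^ 2 / δ)
  exact key n c hc ((div_le_iff₀ hδ).1 hn)

/-- The spectral theorem: refine the spectral idempotents of `x` into primitive ones. -/
theorem nonempty_spectralDecomposition (x : J) : Nonempty (SpectralDecomposition x) := by
  obtain ⟨s, v, hv, hone, hx⟩ := exists_spectral_resolution x
  choose l hl hls using fun r => exists_primitive_list (hv r)
  let ι := Σ r : s, Fin (l r).length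
  let e : ι ≃ Fin (Fintype.card ι) := Fintype.equivFin ι
  let q : ι → J := fun k => (l k.1).get k.2
  have hsum : ∀ r : s, ∑ k, q ⟨r, k⟩ = v r := fun r => by
    rw [← hls r]
    conv_rhs => rw [← List.ofFn_get (l r), List.sum_ofFn]
  have hq : ∀ k, IsPrimitiveIdempotent (q k) := fun k => hl k.1 _ (List.get_mem _ _)
  have hq1 : ∑ k, q k = 1 := by
    rw [Fintype.sum_sigma, ← hone, ← Finset.sum_coe_sort s]
    exact Finset.sum_congr rfl fun r _ => hsum r
  refine ⟨⟨Fintype.card ι, fun k => (e.symm k).1, fun k => q (e.symm k),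
    ⟨fun k => hq _, fun i j hij => ?_, ?_⟩, ?_⟩⟩
  · exact orthogonal_of_sum_eq_one (fun k => (hq k).idem) hq1 (by simpa using hij)
  · rw [Equiv.sum_comp e.symm q, hq1]
  · rw [Equiv.sum_comp e.symm (fun k : ι => (k.1 : ℝ) • q k), Fintype.sum_sigma, ← hx,
      ← Finset.sum_coe_sort s]
    refine Finset.sum_congr rfl fun r _ => ?_
    rw [← hsum r, Finset.smul_sum]

/-! ### Primitive idempotents and the trace -/

/-- Elements over the same Jordan frame multiply coordinatewise. -/
lemma IsJordanFrame.sum_mul_sum {n : ℕ} {q : Fin n → J} (hq : IsJordanFrame q) (a b : Fin n → ℝ) :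
    (∑ i, a i • q i) * (∑ i, b i • q i) = ∑ i, (a i * b i) • q i := by
  rw [sum_mul]
  refine Finset.sum_congr rfl fun i _ => ?_
  rw [mul_sum, Finset.sum_eq_single i]
  · rw [smul_mul_assoc, mul_smul_comm, (hq.primitive i).idem, smul_smul]
  · intro j _ hj
    rw [smul_mul_assoc, mul_smul_comm, hq.orthogonal i j hj.symm, smul_zero, smul_zero]
  · simp

lemma IsJordanFrame.sum_mul {n : ℕ} {q : Fin n → J} (hq : IsJordanFrame q) (a : Fin n → ℝ)
    (i : Fin n) : (∑ j, a j • q j) * q i = a i • q i := by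
  rw [Finset.sum_mul, Finset.sum_eq_single i]
  · rw [smul_mul_assoc, (hq.primitive i).idem]
  · intro j _ hj
    rw [smul_mul_assoc, hq.orthogonal j i hj, smul_zero]
  · simp

lemma SpectralDecomposition.mul_frame {x : J} (d : SpectralDecomposition x) (i : Fin d.card) :
    x * d.frame i = d.eigenvalue i • d.frame i := by
  conv_lhs => enter [1]; rw [d.eq_sum]
  exact d.isJordanFrame.sum_mul _ i

/-- The Peirce `1`-space of a primitive idempotent is a line. -/
lemma IsPrimitiveIdempotent.exists_eq_smul {q : J} (hq : IsPrimitiveIdempotent q) {x : J}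
    (hx : q * x = x) : ∃ r : ℝ, x = r • q := by
  obtain ⟨d⟩ := nonempty_spectralDecomposition x
  have hp := d.isJordanFrame.primitive
  have h0 : ⟪1 - q, x * x⟫_ℝ = 0 := by
    rw [← inner_mul_assoc, mul_sub, mul_one, mul_comm x q, hx, sub_self, inner_zero_left]
  have hxx : x * x = ∑ i, (d.eigenvalue i * d.eigenvalue i) • d.frame i := by
    conv_lhs => rw [d.eq_sum]
    exact d.isJordanFrame.sum_mul_sum _ _
  rw [hxx, inner_sum] at h0
  have hterm : ∀ i, 0 ≤ ⟪1 - q, (d.eigenvalue i * d.eigenvalue i) • d.frame i⟫_ℝ := fun i => by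
    rw [real_inner_smul_right]
    exact mul_nonneg (mul_self_nonneg _)
      (inner_idempotent_nonneg (one_sub_idem hq.idem) (hp i).idem)
  have hall := (Finset.sum_eq_zero_iff_of_nonneg fun i _ => hterm i).1 h0
  have hi : ∀ i, d.eigenvalue i • d.frame i = d.eigenvalue i • q := fun i => by
    by_cases hl : d.eigenvalue i = 0
    · simp [hl]
    have h1 := hall i (mem_univ i)
    rw [real_inner_smul_right, mul_eq_zero] at h1
    have h2 := mul_eq_zero_of_inner_eq_zero (one_sub_idem hq.idem) (hp i).idem
      (h1.resolve_left (mul_ne_zero hl hl))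
    rw [sub_mul, one_mul, sub_eq_zero] at h2
    -- `frame i` is now an idempotent below `q`, so primitivity of `q` makes them equal
    have h3 : (q - d.frame i) * (q - d.frame i) = q - d.frame i := by
      rw [mul_sub, sub_mul, sub_mul, hq.idem, mul_comm (d.frame i) q, ← h2, (hp i).idem]
      abel
    rcases hq.primitive _ _ h3 (hp i).idem (sub_add_cancel _ _) with h | h
    · rw [sub_eq_zero.1 h]
    · exact absurd h (hp i).ne_zero
  exact ⟨∑ i, d.eigenvalue i, by
    conv_lhs => rw [d.eq_sum]
    rw [Finset.sum_smul]; exact Finset.sum_congr rfl fun i _ => hi i⟩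

/-- The norm of `q * s` in terms of `‖q‖` and `⟪q, s⟫`, cleared of denominators. -/
lemma IsPrimitiveIdempotent.norm_sq_mul {q s : J} (hq : IsPrimitiveIdempotent q)
    (hs : s * s = s) :
    ‖q * s‖ ^ 2 * (2 * ‖q‖ ^ 2) = (‖q‖ ^ 2 + ⟪q, s⟫_ℝ) * ⟪q, s⟫_ℝ := by
  -- the Peirce `1`-component of `s` with respect to `q`
  obtain ⟨r, hr⟩ := hq.exists_eq_smul (x := (2 : ℝ) • (q * (q * s)) - q * s) (by
    have h := idempotent_cubic hq.idem s
    rw [mul_sub, mul_smul_comm]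
    have h' : (2 : ℝ) • (q * (q * (q * s))) = (3 : ℝ) • (q * (q * s)) - q * s := by
      rw [sub_eq_iff_eq_add'.1 h.symm]; abel
    rw [h']; module)
  have hqu : ∀ u, ⟪q * u, q⟫_ℝ = ⟪u, q⟫_ℝ := fun u => by rw [inner_mul_assoc, hq.idem]
  have h1 := congrArg (fun u => ⟪u, q⟫_ℝ) hr
  have h2 := congrArg (fun u => ⟪u, s⟫_ℝ) hr
  simp only [inner_sub_left, real_inner_smul_left, hqu] at h1 h2
  rw [inner_mul_assoc q (q * s) s, ← inner_idempotent_eq hs] at h2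
  rw [real_inner_self_eq_norm_sq] at h1 h2
  rw [real_inner_comm] at h1
  linear_combination ‖q‖ ^ 2 * h2 - ⟪q, s⟫_ℝ * h1

/-- Primitive idempotents that are not orthogonal have the same norm: both norms are determined by
`‖q * s‖` and `⟪q, s⟫` through the same formula. -/
lemma IsPrimitiveIdempotent.norm_sq_eq {q s : J} (hq : IsPrimitiveIdempotent q)
    (hs : IsPrimitiveIdempotent s) (h : ⟪q, s⟫_ℝ ≠ 0) : ‖q‖ ^ 2 = ‖s‖ ^ 2 := by
  have h1 := hq.norm_sq_mul hs.idem
  have h2 := hs.norm_sq_mul hq.idem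
  rw [mul_comm s q, real_inner_comm] at h2
  have h3 : ⟪q, s⟫_ℝ ^ 2 * (‖q‖ ^ 2 - ‖s‖ ^ 2) = 0 := by
    linear_combination ‖s‖ ^ 2 * h1 - ‖q‖ ^ 2 * h2
  exact sub_eq_zero.1 ((mul_eq_zero.1 h3).resolve_left (pow_ne_zero 2 h))

/-- There is an element which acts on every primitive idempotent `s` as the scalar `1 / ‖s‖²`. -/
lemma exists_traceVector (J : Type*) [EuclideanJordanAlgebra J] :
    ∃ w : J, ∀ s : J, IsPrimitiveIdempotent s → w * s = (‖s‖ ^ 2)⁻¹ • s := by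
  obtain ⟨d⟩ := nonempty_spectralDecomposition (1 : J)
  have hp := d.isJordanFrame.primitive
  refine ⟨∑ i, (‖d.frame i‖ ^ 2)⁻¹ • d.frame i, fun s hs => ?_⟩
  have hi : ∀ i, ((‖d.frame i‖ ^ 2)⁻¹ • d.frame i) * s = (‖s‖ ^ 2)⁻¹ • (d.frame i * s) :=
    fun i => by
      rw [smul_mul_assoc]
      by_cases h : ⟪d.frame i, s⟫_ℝ = 0
      · rw [mul_eq_zero_of_inner_eq_zero (hp i).idem hs.idem h, smul_zero, smul_zero]
      · rw [(hp i).norm_sq_eq hs h]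
  rw [Finset.sum_mul, Finset.sum_congr rfl fun i _ => hi i, ← Finset.smul_sum, ← Finset.sum_mul,
    d.isJordanFrame.sum_eq_one, one_mul]

/-- An element representing the trace through the given inner product. -/
noncomputable def traceVector (J : Type*) [EuclideanJordanAlgebra J] : J :=
  (exists_traceVector J).choose

lemma traceVector_mul {s : J} (hs : IsPrimitiveIdempotent s) :
    traceVector J * s = (‖s‖ ^ 2)⁻¹ • s :=
  (exists_traceVector J).choose_spec s hs

lemma IsPrimitiveIdempotent.norm_sq_pos {s : J} (hs : IsPrimitiveIdempotent s) : 0 < ‖s‖ ^ 2 :=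
  pow_pos (norm_pos_iff.2 hs.ne_zero) 2

lemma inner_traceVector {s : J} (hs : IsPrimitiveIdempotent s) : ⟪traceVector J, s⟫_ℝ = 1 := by
  rw [inner_idempotent_eq hs.idem, traceVector_mul hs, real_inner_smul_left,
    real_inner_self_eq_norm_sq, inv_mul_cancel₀ hs.norm_sq_pos.ne']

/-- The trace does not depend on the spectral decomposition, and it is linear. -/
lemma tr_eq_inner (x : J) : tr x = ⟪traceVector J, x⟫_ℝ := by
  have h := nonempty_spectralDecomposition x
  rw [tr, dif_pos h]
  conv_rhs => rw [h.some.eq_sum]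
  rw [inner_sum]
  refine Finset.sum_congr rfl fun i _ => ?_
  rw [real_inner_smul_right, inner_traceVector (h.some.isJordanFrame.primitive i), mul_one]

lemma tr_add (x y : J) : tr (x + y) = tr x + tr y := by simp only [tr_eq_inner, inner_add_right]

lemma tr_sub (x y : J) : tr (x - y) = tr x - tr y := by simp only [tr_eq_inner, inner_sub_right]

lemma tr_smul (r : ℝ) (x : J) : tr (r • x) = r * tr x := by
  simp only [tr_eq_inner, real_inner_smul_right]

lemma tr_sum {ι : Type*} (s : Finset ι) (f : ι → J) : tr (∑ i ∈ s, f i) = ∑ i ∈ s, tr (f i) := by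
  simp only [tr_eq_inner, inner_sum]

lemma IsPrimitiveIdempotent.tr_eq_one {s : J} (hs : IsPrimitiveIdempotent s) : tr s = 1 := by
  rw [tr_eq_inner, inner_traceVector hs]

lemma IsJordanFrame.tr_sum_smul {n : ℕ} {q : Fin n → J} (hq : IsJordanFrame q) (a : Fin n → ℝ) :
    tr (∑ i, a i • q i) = ∑ i, a i := by
  simp [tr_sum, tr_smul, (hq.primitive _).tr_eq_one]

lemma tr_mul_nonneg {q s : J} (hq : IsPrimitiveIdempotent q) (hs : IsPrimitiveIdempotent s) :
    0 ≤ tr (q * s) := by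
  rw [tr_eq_inner, mul_comm, ← inner_mul_assoc, mul_comm, traceVector_mul hs,
    real_inner_smul_left]
  exact mul_nonneg (inv_nonneg.2 hs.norm_sq_pos.le) (inner_idempotent_nonneg hs.idem hq.idem)

/-! ### Functional calculus and the cone of squares -/

namespace SpectralDecomposition

variable {x y : J}

lemma tr_eq (d : SpectralDecomposition x) : tr x = ∑ i, d.eigenvalue i := by
  conv_lhs => rw [d.eq_sum]
  exact d.isJordanFrame.tr_sum_smul _

/-- Spectral projections of the same element for different eigenvalues are orthogonal. -/
lemma frame_mul_frame (d d' : SpectralDecomposition x) {i : Fin d.card} {j : Fin d'.card}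
    (h : d.eigenvalue i ≠ d'.eigenvalue j) : d.frame i * d'.frame j = 0 := by
  apply mul_eq_zero_of_inner_eq_zero (d.isJordanFrame.primitive i).idem
    (d'.isJordanFrame.primitive j).idem
  have h1 := inner_mul_assoc x (d.frame i) (d'.frame j)
  rw [d.mul_frame, d'.mul_frame, real_inner_smul_left, real_inner_smul_right, ← sub_eq_zero,
    ← sub_mul] at h1
  exact (mul_eq_zero.1 h1).resolve_left (sub_ne_zero.2 h)

/-- The Löwner extension does not depend on the spectral decomposition. -/
lemma lowner_eq (f : ℝ → ℝ) (d : SpectralDecomposition x) :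
    lowner f x = ∑ i, f (d.eigenvalue i) • d.frame i := by
  have h : Nonempty (SpectralDecomposition x) := ⟨d⟩
  rw [lowner, dif_pos h]
  set d' := h.some
  calc ∑ i, f (d'.eigenvalue i) • d'.frame i
      = ∑ i, ∑ j, f (d'.eigenvalue i) • (d'.frame i * d.frame j) := by
        refine Finset.sum_congr rfl fun i _ => ?_
        rw [← Finset.smul_sum, ← mul_sum, d.isJordanFrame.sum_eq_one, mul_one]
    _ = ∑ i, ∑ j, f (d.eigenvalue j) • (d'.frame i * d.frame j) := by
        refine Finset.sum_congr rfl fun i _ => Finset.sum_congr rfl fun j _ => ?_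
        by_cases hij : d'.eigenvalue i = d.eigenvalue j
        · rw [hij]
        · rw [d'.frame_mul_frame d hij, smul_zero, smul_zero]
    _ = ∑ j, f (d.eigenvalue j) • d.frame j := by
        rw [Finset.sum_comm]
        refine Finset.sum_congr rfl fun j _ => ?_
        rw [← Finset.smul_sum, ← Finset.sum_mul, d'.isJordanFrame.sum_eq_one, one_mul]

lemma entropy_eq (d : SpectralDecomposition x) :
    entropy x = ∑ i, d.eigenvalue i * Real.log (d.eigenvalue i) := by
  rw [entropy, jlog, d.lowner_eq]
  conv_lhs => enter [1, 1]; rw [d.eq_sum]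
  rw [d.isJordanFrame.sum_mul_sum, d.isJordanFrame.tr_sum_smul]

lemma eigenvalue_mul_norm_sq (d : SpectralDecomposition x) (i : Fin d.card) :
    d.eigenvalue i * ‖d.frame i‖ ^ 2 = ⟪x, d.frame i⟫_ℝ := by
  rw [inner_idempotent_eq (d.isJordanFrame.primitive i).idem, d.mul_frame, real_inner_smul_left,
    real_inner_self_eq_norm_sq]

lemma eigenvalue_nonneg (d : SpectralDecomposition x) (hx : x ∈ cone J) (i : Fin d.card) :
    0 ≤ d.eigenvalue i := by
  obtain ⟨y, rfl⟩ := hx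
  have hp := d.isJordanFrame.primitive i
  refine nonneg_of_mul_nonneg_left ?_ hp.norm_sq_pos
  rw [d.eigenvalue_mul_norm_sq, inner_mul_assoc, mul_comm, real_inner_comm]
  exact inner_idempotent_mul_nonneg hp.idem y

lemma mem_cone (d : SpectralDecomposition x) (h : ∀ i, 0 ≤ d.eigenvalue i) : x ∈ cone J := by
  refine ⟨∑ i, √(d.eigenvalue i) • d.frame i, ?_⟩
  rw [d.isJordanFrame.sum_mul_sum]
  conv_rhs => rw [d.eq_sum]
  exact Finset.sum_congr rfl fun i _ => by rw [Real.mul_self_sqrt (h i)]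

lemma inner_ge (d : SpectralDecomposition x) {r : ℝ} (h : ∀ i, r ≤ d.eigenvalue i) {c : J}
    (hc : c * c = c) : r * ‖c‖ ^ 2 ≤ ⟪x, c⟫_ℝ := by
  rw [← inner_one_idempotent hc, ← d.isJordanFrame.sum_eq_one, sum_inner, mul_sum]
  conv_rhs => rw [d.eq_sum, sum_inner]
  refine Finset.sum_le_sum fun i _ => ?_
  rw [real_inner_smul_left]
  exact mul_le_mul_of_nonneg_right (h i)
    (inner_idempotent_nonneg (d.isJordanFrame.primitive i).idem hc)

/-- An element with positive eigenvalues is an interior point of the cone of squares: the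
eigenvalues of a perturbation `h` are at least `-C * ‖h‖`. -/
lemma mem_interior_cone (d : SpectralDecomposition x) (h : ∀ i, 0 < d.eigenvalue i) :
    x ∈ interior (cone J) := by
  obtain ⟨r, hr, hrd⟩ : ∃ r : ℝ, 0 < r ∧ ∀ i, r ≤ d.eigenvalue i := by
    rcases isEmpty_or_nonempty (Fin d.card) with hE | hE
    · exact ⟨1, one_pos, fun i => hE.elim i⟩
    · obtain ⟨k, hk⟩ := Finite.exists_min d.eigenvalue
      exact ⟨_, h k, hk⟩
  obtain ⟨C, hC, hmul⟩ := exists_norm_mul_le J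
  rw [mem_interior_iff_mem_nhds, Metric.mem_nhds_iff]
  refine ⟨r / C, by positivity, fun z hz => ?_⟩
  obtain ⟨e⟩ := nonempty_spectralDecomposition z
  refine e.mem_cone fun i => ?_
  have hp := e.isJordanFrame.primitive i
  refine nonneg_of_mul_nonneg_left ?_ hp.norm_sq_pos
  rw [e.eigenvalue_mul_norm_sq]
  have h1 := d.inner_ge hrd hp.idem
  have h2 : |⟪z - x, e.frame i⟫_ℝ| ≤ C * ‖z - x‖ * ‖e.frame i‖ * ‖e.frame i‖ := by
    rw [inner_idempotent_eq hp.idem]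
    exact (abs_real_inner_le_norm _ _).trans
      (mul_le_mul_of_nonneg_right (hmul _ _) (norm_nonneg _))
  rw [mem_ball_iff_norm, lt_div_iff₀ hC] at hz
  have h3 := (abs_le.1 h2).1
  rw [inner_sub_left] at h3
  nlinarith [mul_le_mul_of_nonneg_right hz.le hp.norm_sq_pos.le]

end SpectralDecomposition

/-! ### Klein's inequality -/

/-- The integrand `a ln a - a ln b - a + b` of the relative entropy. -/
noncomputable def scalarGap (a b : ℝ) : ℝ := a * Real.log a - a * Real.log b - a + b

lemma scalarGap_nonneg {a b : ℝ} (ha : 0 ≤ a) (hb : 0 < b) : 0 ≤ scalarGap a b := by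
  rcases ha.eq_or_lt with rfl | ha
  · simp [scalarGap, hb.le]
  have h := Real.log_le_sub_one_of_pos (div_pos hb ha)
  rw [Real.log_div hb.ne' ha.ne'] at h
  have h2 := mul_le_mul_of_nonneg_left h ha.le
  rw [mul_sub a (b / a), mul_div_cancel₀ _ ha.ne'] at h2
  unfold scalarGap; linarith

lemma scalarGap_pos {a b : ℝ} (ha : 0 ≤ a) (hb : 0 < b) (hab : a ≠ b) : 0 < scalarGap a b := by
  rcases ha.eq_or_lt with rfl | ha
  · simp [scalarGap, hb]
  have h := Real.log_lt_sub_one_of_pos (div_pos hb ha)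
    (fun h => hab ((div_eq_one_iff_eq ha.ne').1 h).symm)
  rw [Real.log_div hb.ne' ha.ne'] at h
  have h2 := mul_lt_mul_of_pos_left h ha
  rw [mul_sub a (b / a), mul_div_cancel₀ _ ha.ne'] at h2
  unfold scalarGap; linarith

lemma scalarGap_le {a b : ℝ} (ha : 0 ≤ a) (hb : 0 < b) : scalarGap a b ≤ b⁻¹ * (a - b) ^ 2 := by
  rcases ha.eq_or_lt with rfl | ha
  · apply le_of_eq; simp [scalarGap]; field_simp
  have h := Real.log_le_sub_one_of_pos (div_pos ha hb)
  rw [Real.log_div ha.ne' hb.ne'] at h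
  have h2 := mul_le_mul_of_nonneg_left h ha.le
  have h3 : b⁻¹ * (a - b) ^ 2 = a * (a / b - 1) - a + b := by field_simp; ring
  unfold scalarGap; linarith

/-- The relative entropy `tr (x ∘ ln x - x ∘ ln y - x + y)`, meaningful when `x` lies in the cone of
squares and `y` in its interior. -/
noncomputable def relEntropy (x y : J) : ℝ := entropy x - tr (x * jlog y) - tr x + tr y

section Klein

variable {x y : J} (d : SpectralDecomposition x) (e : SpectralDecomposition y)

lemma tr_sum_mul_sum {m n : ℕ} (a : Fin m → ℝ) (b : Fin n → ℝ) (q : Fin m → J) (s : Fin n → J) :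
    tr ((∑ i, a i • q i) * (∑ j, b j • s j)) = ∑ i, ∑ j, a i * b j * tr (q i * s j) := by
  rw [Finset.sum_mul, tr_sum]
  refine Finset.sum_congr rfl fun i _ => ?_
  rw [mul_sum, tr_sum]
  refine Finset.sum_congr rfl fun j _ => ?_
  rw [smul_mul_assoc, mul_smul_comm, tr_smul, tr_smul, mul_assoc]

/-- The overlaps of an element of the first frame with the second frame sum up to `1`. -/
lemma sum_eq_sum_overlap_left (a : Fin d.card → ℝ) :
    ∑ i, a i = ∑ i, ∑ j, a i * tr (d.frame i * e.frame j) := by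
  refine Finset.sum_congr rfl fun i _ => ?_
  rw [← mul_sum, ← tr_sum, ← mul_sum, e.isJordanFrame.sum_eq_one, mul_one,
    (d.isJordanFrame.primitive i).tr_eq_one, mul_one]

/-- The overlaps of an element of the second frame with the first frame sum up to `1`. -/
lemma sum_eq_sum_overlap_right (b : Fin e.card → ℝ) :
    ∑ j, b j = ∑ i, ∑ j, b j * tr (d.frame i * e.frame j) := by
  rw [Finset.sum_comm]
  refine Finset.sum_congr rfl fun j _ => ?_
  rw [← mul_sum, ← tr_sum, ← Finset.sum_mul, d.isJordanFrame.sum_eq_one, one_mul,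
    (e.isJordanFrame.primitive j).tr_eq_one, mul_one]

lemma relEntropy_eq_sum : relEntropy x y =
    ∑ i, ∑ j, scalarGap (d.eigenvalue i) (e.eigenvalue j) * tr (d.frame i * e.frame j) := by
  have h1 : tr (x * jlog y) = ∑ i, ∑ j, d.eigenvalue i * Real.log (e.eigenvalue j) *
      tr (d.frame i * e.frame j) := by
    rw [jlog, e.lowner_eq]
    conv_lhs => enter [1, 1]; rw [d.eq_sum]
    rw [tr_sum_mul_sum]
  rw [relEntropy, d.entropy_eq, d.tr_eq, e.tr_eq, h1, sum_eq_sum_overlap_left d e,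
    sum_eq_sum_overlap_left d e d.eigenvalue, sum_eq_sum_overlap_right d e e.eigenvalue]
  simp only [← Finset.sum_sub_distrib, ← Finset.sum_add_distrib, ← sub_mul, ← add_mul, scalarGap]

lemma tr_sq_sub_eq_sum : tr ((x - y) * (x - y)) =
    ∑ i, ∑ j, (d.eigenvalue i - e.eigenvalue j) ^ 2 * tr (d.frame i * e.frame j) := by
  have hxx : ∀ {z : J} (c : SpectralDecomposition z),
      tr (z * z) = ∑ i, c.eigenvalue i * c.eigenvalue i := fun {z} c => by
    conv_lhs => rw [c.eq_sum]
    rw [c.isJordanFrame.sum_mul_sum, c.isJordanFrame.tr_sum_smul]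
  have hxy : tr (x * y) =
      ∑ i, ∑ j, d.eigenvalue i * e.eigenvalue j * tr (d.frame i * e.frame j) := by
    conv_lhs => rw [d.eq_sum, e.eq_sum]
    rw [tr_sum_mul_sum]
  have h : (x - y) * (x - y) = x * x - (2 : ℝ) • (x * y) + y * y := by
    rw [mul_sub, sub_mul, sub_mul, mul_comm y x]; module
  rw [h, tr_add, tr_sub, tr_smul, hxx d, hxx e, hxy, sum_eq_sum_overlap_left d e,
    sum_eq_sum_overlap_right d e]
  simp only [mul_sum, ← Finset.sum_sub_distrib, ← Finset.sum_add_distrib]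
  exact Finset.sum_congr rfl fun i _ => Finset.sum_congr rfl fun j _ => by ring

lemma tr_overlap_nonneg (i : Fin d.card) (j : Fin e.card) : 0 ≤ tr (d.frame i * e.frame j) :=
  tr_mul_nonneg (d.isJordanFrame.primitive i) (e.isJordanFrame.primitive j)

lemma eq_zero_of_tr_sq_eq_zero (h : tr (x * x) = 0) : x = 0 := by
  obtain ⟨d⟩ := nonempty_spectralDecomposition x
  have h1 : tr (x * x) = ∑ i, d.eigenvalue i * d.eigenvalue i := by
    conv_lhs => rw [d.eq_sum]
    rw [d.isJordanFrame.sum_mul_sum, d.isJordanFrame.tr_sum_smul]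
  rw [h1, Finset.sum_eq_zero_iff_of_nonneg fun i _ => mul_self_nonneg _] at h
  rw [d.eq_sum]
  exact Finset.sum_eq_zero fun i hi => by rw [mul_self_eq_zero.1 (h i hi), zero_smul]

end Klein

variable {x y : J}

lemma relEntropy_nonneg (hx : x ∈ cone J) (e : SpectralDecomposition y)
    (he : ∀ j, 0 < e.eigenvalue j) : 0 ≤ relEntropy x y := by
  obtain ⟨d⟩ := nonempty_spectralDecomposition x
  rw [relEntropy_eq_sum d e]
  exact Finset.sum_nonneg fun i _ => Finset.sum_nonneg fun j _ =>
    mul_nonneg (scalarGap_nonneg (d.eigenvalue_nonneg hx i) (he j)) (tr_overlap_nonneg d e i j)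

/-- Equality in Klein's inequality: frame elements with different eigenvalues have zero overlap,
so `tr ((x - y)²) = 0`. -/
lemma relEntropy_pos (hx : x ∈ cone J) (e : SpectralDecomposition y)
    (he : ∀ j, 0 < e.eigenvalue j) (hxy : x ≠ y) : 0 < relEntropy x y := by
  obtain ⟨d⟩ := nonempty_spectralDecomposition x
  refine lt_of_le_of_ne (relEntropy_nonneg hx e he) fun h => hxy ?_
  have hterm : ∀ i j, 0 ≤ scalarGap (d.eigenvalue i) (e.eigenvalue j) *
      tr (d.frame i * e.frame j) := fun i j =>
    mul_nonneg (scalarGap_nonneg (d.eigenvalue_nonneg hx i) (he j)) (tr_overlap_nonneg d e i j)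
  rw [relEntropy_eq_sum d e, eq_comm,
    Finset.sum_eq_zero_iff_of_nonneg fun i _ => Finset.sum_nonneg fun j _ => hterm i j] at h
  refine sub_eq_zero.1 (eq_zero_of_tr_sq_eq_zero ?_)
  rw [tr_sq_sub_eq_sum d e]
  refine Finset.sum_eq_zero fun i hi => Finset.sum_eq_zero fun j hj => ?_
  have hij := (Finset.sum_eq_zero_iff_of_nonneg fun j _ => hterm i j).1 (h i hi) j hj
  by_cases hl : d.eigenvalue i = e.eigenvalue j
  · simp [hl]
  · rw [(mul_eq_zero.1 hij).resolve_left
      (scalarGap_pos (d.eigenvalue_nonneg hx i) (he j) hl).ne', mul_zero]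

lemma relEntropy_le (hx : x ∈ cone J) (e : SpectralDecomposition y)
    (he : ∀ j, 0 < e.eigenvalue j) :
    relEntropy x y ≤ (∑ j, (e.eigenvalue j)⁻¹) * tr ((x - y) * (x - y)) := by
  obtain ⟨d⟩ := nonempty_spectralDecomposition x
  rw [relEntropy_eq_sum d e, tr_sq_sub_eq_sum d e, mul_sum]
  refine Finset.sum_le_sum fun i _ => ?_
  rw [mul_sum]
  refine Finset.sum_le_sum fun j _ => ?_
  rw [← mul_assoc]
  refine mul_le_mul_of_nonneg_right ?_ (tr_overlap_nonneg d e i j)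
  refine (scalarGap_le (d.eigenvalue_nonneg hx i) (he j)).trans
    (mul_le_mul_of_nonneg_right ?_ (sq_nonneg _))
  exact Finset.single_le_sum (f := fun j => (e.eigenvalue j)⁻¹)
    (fun k _ => inv_nonneg.2 (he k).le) (mem_univ j)

/-- The functional `h ↦ tr ((ln y + 1) ∘ h)`, the derivative of the entropy at `y`. -/
noncomputable def entropyDeriv (y : J) : J →L[ℝ] ℝ :=
  LinearMap.toContinuousLinearMap
    ((innerSL ℝ (traceVector J)).toLinearMap ∘ₗ LinearMap.mulLeft ℝ (jlog y + 1))

lemma entropyDeriv_apply (y h : J) : entropyDeriv y h = tr ((jlog y + 1) * h) := by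
  rw [tr_eq_inner]; rfl

lemma relEntropy_eq_sub (x y : J) :
    entropy x - entropy y - entropyDeriv y (x - y) = relEntropy x y := by
  rw [entropyDeriv_apply, add_mul, one_mul, mul_sub, tr_add, tr_sub, tr_sub, relEntropy,
    mul_comm (jlog y) x, mul_comm (jlog y) y]
  have : entropy y = tr (y * jlog y) := rfl
  linarith

/-- The relative entropy is the remainder of the first-order expansion of the entropy; Klein's
inequality and its quadratic counterpart bound it between `0` and a multiple of `‖x - y‖²`. -/
lemma hasFDerivAt_entropy (e : SpectralDecomposition y) (he : ∀ j, 0 < e.eigenvalue j) :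
    HasFDerivAt (entropy : J → ℝ) (entropyDeriv y) y := by
  obtain ⟨C, hC, hmul⟩ := exists_norm_mul_le J
  have hS : 0 ≤ ∑ j, (e.eigenvalue j)⁻¹ := Finset.sum_nonneg fun j _ => inv_nonneg.2 (he j).le
  have hO : (fun x => entropy x - entropy y - entropyDeriv y (x - y)) =O[nhds y]
      fun x => ‖x - y‖ ^ 2 := by
    refine Asymptotics.IsBigO.of_bound ((∑ j, (e.eigenvalue j)⁻¹) * (‖traceVector J‖ * C)) ?_
    filter_upwards [mem_interior_iff_mem_nhds.1 (e.mem_interior_cone he)] with x hx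
    rw [relEntropy_eq_sub, Real.norm_of_nonneg (relEntropy_nonneg hx e he),
      Real.norm_of_nonneg (sq_nonneg _), mul_assoc]
    refine (relEntropy_le hx e he).trans (mul_le_mul_of_nonneg_left ?_ hS)
    rw [tr_eq_inner]
    refine (real_inner_le_norm _ _).trans ?_
    rw [mul_assoc]
    refine mul_le_mul_of_nonneg_left ((hmul _ _).trans_eq (by ring)) (norm_nonneg _)
  refine HasFDerivAt.of_isLittleO (hO.trans_isLittleO ?_)
  have h0 : Filter.Tendsto (fun x : J => ‖x - y‖) (nhds y) (nhds 0) := by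
    have : Continuous fun x : J => ‖x - y‖ := by fun_prop
    simpa using this.tendsto y
  simp only [pow_two]
  exact (((Asymptotics.isLittleO_one_iff ℝ).2 h0).mul_isBigO
    (Asymptotics.isBigO_refl (fun x : J => ‖x - y‖) _)).trans_isBigO
      (by simpa using (Asymptotics.isBigO_refl (fun x : J => x - y) _).norm_left)

lemma bregman_eq_relEntropy (x : J) (e : SpectralDecomposition y)
    (he : ∀ j, 0 < e.eigenvalue j) : bregman x y = relEntropy x y := by
  rw [bregman, (hasFDerivAt_entropy e he).fderiv, relEntropy_eq_sub]

/-! ### Gibbs variational principle -/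

lemma IsArgmin.eq {α : Type*} {S : Set α} {f : α → ℝ} {p q : α} (hp : IsArgmin S f p)
    (hq : IsArgmin S f q) : p = q := by
  by_contra h
  exact lt_asymm (hp.2 q hq.1 (Ne.symm h)) (hq.2 p hp.1 h)

lemma trInner_smul_sum (r : ℝ) (s : Finset ℕ) (m : ℕ → J) (x : J) :
    trInner (r • ∑ i ∈ s, m i) x = r * ∑ i ∈ s, trInner (m i) x := by
  simp only [trInner, smul_mul_assoc, Finset.sum_mul, tr_smul, tr_sum]

/-- The normalized exponential of `a`. -/
noncomputable def gibbs (a : J) : J := (tr (jexp a))⁻¹ • jexp a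

variable {a : J}

lemma SpectralDecomposition.tr_jexp (d : SpectralDecomposition a) :
    tr (jexp a) = ∑ i, Real.exp (d.eigenvalue i) := by
  rw [jexp, d.lowner_eq, d.isJordanFrame.tr_sum_smul]

lemma tr_jexp_pos [Nontrivial J] (a : J) : 0 < tr (jexp a) := by
  obtain ⟨d⟩ := nonempty_spectralDecomposition a
  rw [d.tr_jexp]
  refine Finset.sum_pos (fun i _ => Real.exp_pos _) ?_
  by_contra h
  have h1 := d.isJordanFrame.sum_eq_one
  rw [Finset.not_nonempty_iff_eq_empty.1 h, Finset.sum_empty] at h1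
  exact zero_ne_one h1

/-- The spectral decomposition of the normalized exponential of `a` over a frame of `a`. -/
noncomputable def SpectralDecomposition.gibbs (d : SpectralDecomposition a) :
    SpectralDecomposition (gibbs a) where
  card := d.card
  eigenvalue i := (tr (jexp a))⁻¹ * Real.exp (d.eigenvalue i)
  frame := d.frame
  isJordanFrame := d.isJordanFrame
  eq_sum := by
    rw [SymmetricCone.gibbs]
    conv_lhs => enter [2]; rw [jexp, d.lowner_eq]
    rw [Finset.smul_sum]
    exact Finset.sum_congr rfl fun i _ => smul_smul _ _ _

variable [Nontrivial J]

lemma SpectralDecomposition.gibbs_eigenvalue_pos (d : SpectralDecomposition a)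
    (i : Fin d.gibbs.card) : 0 < d.gibbs.eigenvalue i :=
  mul_pos (inv_pos.2 (tr_jexp_pos a)) (Real.exp_pos _)

lemma jlog_gibbs (a : J) : jlog (gibbs a) = a - Real.log (tr (jexp a)) • (1 : J) := by
  obtain ⟨d⟩ := nonempty_spectralDecomposition a
  have h : ∀ i, Real.log ((tr (jexp a))⁻¹ * Real.exp (d.eigenvalue i)) =
      d.eigenvalue i - Real.log (tr (jexp a)) := fun i => by
    rw [Real.log_mul (inv_ne_zero (tr_jexp_pos a).ne') (Real.exp_ne_zero _), Real.log_inv,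
      Real.log_exp]
    ring
  rw [jlog, d.gibbs.lowner_eq]
  change ∑ i, Real.log ((tr (jexp a))⁻¹ * Real.exp (d.eigenvalue i)) • d.frame i = _
  simp only [h, sub_smul, Finset.sum_sub_distrib]
  rw [← Finset.smul_sum, d.isJordanFrame.sum_eq_one, ← d.eq_sum]

lemma tr_gibbs (a : J) : tr (gibbs a) = 1 := by
  rw [gibbs, tr_smul, inv_mul_cancel₀ (tr_jexp_pos a).ne']

lemma gibbs_mem_interior (a : J) : gibbs a ∈ interior (cone J) := by
  obtain ⟨d⟩ := nonempty_spectralDecomposition a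
  exact d.gibbs.mem_interior_cone d.gibbs_eigenvalue_pos

lemma differentiableAt_gibbs (a : J) : DifferentiableAt ℝ (entropy : J → ℝ) (gibbs a) := by
  obtain ⟨d⟩ := nonempty_spectralDecomposition a
  exact (hasFDerivAt_entropy d.gibbs d.gibbs_eigenvalue_pos).differentiableAt

lemma relEntropy_gibbs (hx : tr x = 1) (a : J) :
    relEntropy x (gibbs a) = entropy x - trInner a x + Real.log (tr (jexp a)) := by
  rw [relEntropy, jlog_gibbs, tr_gibbs, hx, mul_sub, mul_smul_comm, mul_one, tr_sub, tr_smul, hx,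
    trInner, mul_comm a x]
  ring

lemma bregman_gibbs (hx : tr x = 1) (a : J) :
    bregman x (gibbs a) = entropy x - trInner a x + Real.log (tr (jexp a)) := by
  obtain ⟨d⟩ := nonempty_spectralDecomposition a
  rw [bregman_eq_relEntropy x d.gibbs d.gibbs_eigenvalue_pos, relEntropy_gibbs hx]

/-- On the slice, any function which differs from `Φ x - ⟨a, x⟩` by a constant has the normalized
exponential of `a` as its unique minimizer. -/
lemma isArgmin_gibbs {f : J → ℝ} {a : J} (k : ℝ)
    (hf : ∀ x ∈ slice J, f x = entropy x - trInner a x + k) :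
    IsArgmin (slice J) f (gibbs a) := by
  have hmem : gibbs a ∈ slice J := ⟨interior_subset (gibbs_mem_interior a), tr_gibbs a⟩
  refine ⟨hmem, fun x hx hne => ?_⟩
  obtain ⟨d⟩ := nonempty_spectralDecomposition a
  have h1 := relEntropy_pos hx.1 d.gibbs d.gibbs_eigenvalue_pos hne
  have h2 : relEntropy (gibbs a) (gibbs a) = 0 := by simp [relEntropy, entropy]
  rw [relEntropy_gibbs hx.2] at h1
  rw [relEntropy_gibbs (tr_gibbs a)] at h2
  rw [hf x hx, hf _ hmem]
  linarith

lemma isArgmin_ftrl (η : ℝ) (m : ℕ → J) (t : ℕ) : IsArgmin (slice J)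
    (fun x => entropy x + η * ∑ i ∈ Finset.Icc 1 t, trInner (m i) x)
    (gibbs (-η • ∑ i ∈ Finset.Icc 1 t, m i)) :=
  isArgmin_gibbs 0 fun x _ => by rw [trInner_smul_sum]; ring

/-- One mirror-descent step adds `-η • m` to the exponent. -/
lemma isArgmin_omd (η : ℝ) (m : ℕ → J) (t : ℕ) : IsArgmin (slice J)
    (fun x => η * trInner (m (t + 1)) x + bregman x (gibbs (-η • ∑ i ∈ Finset.Icc 1 t, m i)))
    (gibbs (-η • ∑ i ∈ Finset.Icc 1 (t + 1), m i)) :=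
  isArgmin_gibbs (Real.log (tr (jexp (-η • ∑ i ∈ Finset.Icc 1 t, m i)))) fun x hx => by
    rw [bregman_gibbs hx.2, trInner_smul_sum, trInner_smul_sum,
      Finset.sum_Icc_succ_top (Nat.le_add_left 1 t)]
    ring

end SymmetricCone

open SymmetricCone in
theorem mainTheorem1 {J : Type*} [EuclideanJordanAlgebra J] [Nontrivial J]
    (η : ℝ) (m : ℕ → J) (p : ℕ → J) :
    (IsSCMWU η m p ↔ IsFTRL η m p) ∧
    (IsSCMWU η m p ↔ IsOMD η m p) ∧
    (IsSCMWU η m p → ∀ t : ℕ, 1 ≤ t →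
      p t ∈ interior (cone J) ∧ DifferentiableAt ℝ (entropy : J → ℝ) (p t)) := by
  have hS : IsSCMWU η m p ↔ ∀ t, p (t + 1) = gibbs (-η • ∑ i ∈ Finset.Icc 1 t, m i) := Iff.rfl
  have h1 : IsArgmin (slice J) (fun x => entropy x)
      (gibbs (-η • ∑ i ∈ Finset.Icc 1 0, m i)) := by
    simpa using isArgmin_ftrl η m 0
  rw [hS]
  refine ⟨⟨fun h t => ?_, fun h t => (h t).eq (isArgmin_ftrl η m t)⟩,
    ⟨fun h => ⟨?_, fun t ht => ?_⟩, fun h t => ?_⟩, fun h t ht => ?_⟩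
  · rw [h t]; exact isArgmin_ftrl η m t
  · rw [h 0]; exact h1
  · obtain ⟨t, rfl⟩ := Nat.exists_eq_add_of_le' ht
    rw [h t, h (t + 1)]
    exact isArgmin_omd η m t
  · induction t with
    | zero => exact h.1.eq h1
    | succ t ih =>
      have h2 := h.2 (t + 1) (Nat.le_add_left 1 t)
      rw [ih] at h2
      exact h2.eq (isArgmin_omd η m t)
  · obtain ⟨t, rfl⟩ := Nat.exists_eq_add_of_le' ht
    rw [h t]
    exact ⟨gibbs_mem_interior _, differentiableAt_gibbs _⟩
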